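/- Let $H$ be a complex Hilbert space of finite dimension at least $3$. Let $\Lambda^2(H)\subset H\otimes H$ be the space of skew-symmetric tensors, with the inner product induced from $\langle x\otimes u,y\otimes v\rangle=\langle x,y\rangle\langle u,v\rangle$, and put $x\wedge y=\tfrac{1}{\sqrt2}(x\otimes y-y\otimes x)$. Let $E$ be a positive semidefinite self-adjoint operator on $\Lambda^2(H)$. On the projective space $\mathbb{P}(H)$, whose points are represented by unit vectors up to a phase, define $d_E(x,y)=\|E(x\wedge y)\|$, where $x,y$ are unit representatives (the value does not depend on their choice). For a $3$-dimensional subspace $W\subseteq H$ let $\Lambda^2(W)\subseteq\Lambda^2(H)$ be the ($3$-dimensional) span of all $x\wedge y$ with $x,y\in W$, and let $F(W)$ be the restriction of $E^2$ to $\Lambda^2(W)$, that is, the self-adjoint operator on $\Lambda^2(W)$ with $\langle F(W)X,Y\rangle=\langle E^2X,Y\rangle$ for all $X,Y\in\Lambda^2(W)$. Let $\lambda_1(F(W))\ge\lambda_2(F(W))\ge\lambda_3(F(W))\ge 0$ be its eigenvalues, counted with multiplicity. Then the triangle inequality $$d_E(x,y)\le d_E(x,z)+d_E(z,y)\qquad\text{for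 all }x,y,z\in\mathbb{P}(H)$$ holds if and only if, for every $3$-dimensional subspace $W\subseteq H$, $$\sqrt{\lambda_1(F(W))}\le\sqrt{\lambda_2(F(W))}+\sqrt{\lambda_3(F(W))}.$$ -/

import Mathlib

open scoped TensorProduct LinearAlgebra.Projectivization

noncomputable section

namespace QuantumDist

section Exterior

variable {H : Type*} [NormedAddCommGroup H] [InnerProductSpace ℂ H]

/-- The subspace of skew-symmetric tensors in `H ⊗ H`. -/
def skewTensors (H : Type*) [NormedAddCommGroup H] [InnerProductSpace ℂ H] :
    Submodule ℂ (H ⊗[ℂ] H) where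
  carrier := {t | TensorProduct.comm ℂ H H t = -t}
  add_mem' := by
    intro a b ha hb
    change TensorProduct.comm ℂ H H (a + b) = -(a + b)
    have ha' : TensorProduct.comm ℂ H H a = -a := ha
    have hb' : TensorProduct.comm ℂ H H b = -b := hb
    rw [map_add, ha', hb', neg_add]
  zero_mem' := by
    change TensorProduct.comm ℂ H H 0 = -0
    rw [map_zero, neg_zero]
  smul_mem' := by
    intro c a ha
    change TensorProduct.comm ℂ H H (c • a) = -(c • a)
    have ha' : TensorProduct.comm ℂ H H a = -a := ha
    rw [map_smul, ha', smul_neg]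

/-- The exterior square `Λ²(H)`, realized as the space of skew-symmetric tensors in `H ⊗ H`, with
the inner product induced from `⟪x ⊗ u, y ⊗ v⟫ = ⟪x, y⟫ ⟪u, v⟫` on `H ⊗ H`. -/
def ExtSq (H : Type*) [NormedAddCommGroup H] [InnerProductSpace ℂ H] : Type _ :=
  skewTensors H

instance : NormedAddCommGroup (ExtSq H) :=
  inferInstanceAs (NormedAddCommGroup (skewTensors H))

instance : InnerProductSpace ℂ (ExtSq H) :=
  inferInstanceAs (InnerProductSpace ℂ (skewTensors H))

instance [FiniteDimensional ℂ H] : FiniteDimensional ℂ (ExtSq H) :=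
  inferInstanceAs (FiniteDimensional ℂ (skewTensors H))

/-- The inclusion `Λ²(H) ⊆ H ⊗ H`. -/
def ExtSq.toTensor (t : ExtSq H) : H ⊗[ℂ] H := Subtype.val (p := (· ∈ skewTensors H)) t

theorem ExtSq.ext {s t : ExtSq H} (h : s.toTensor = t.toTensor) : s = t := Subtype.ext h

theorem ExtSq.toTensor_add (s t : ExtSq H) : (s + t).toTensor = s.toTensor + t.toTensor := rfl

theorem ExtSq.toTensor_neg (t : ExtSq H) : (-t).toTensor = -t.toTensor := rfl

theorem ExtSq.toTensor_zero : (0 : ExtSq H).toTensor = 0 := rfl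

theorem ExtSq.toTensor_smul (c : ℂ) (t : ExtSq H) : (c • t).toTensor = c • t.toTensor := rfl

theorem ExtSq.inner_eq (s t : ExtSq H) : inner ℂ s t = inner ℂ s.toTensor t.toTensor := rfl

/-- The wedge product `x ∧ y = (x ⊗ y - y ⊗ x) / √2`. -/
def wedge (x y : H) : ExtSq H :=
  ⟨((1 / Real.sqrt 2 : ℝ) : ℂ) • (x ⊗ₜ[ℂ] y - y ⊗ₜ[ℂ] x), by
    change TensorProduct.comm ℂ H H _ = -_
    rw [map_smul, map_sub, TensorProduct.comm_tmul, TensorProduct.comm_tmul, ← smul_neg, neg_sub]⟩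

theorem toTensor_wedge (x y : H) :
    (wedge x y).toTensor = ((1 / Real.sqrt 2 : ℝ) : ℂ) • (x ⊗ₜ[ℂ] y - y ⊗ₜ[ℂ] x) := rfl

theorem inner_wedge (a b x y : H) :
    inner ℂ (wedge a b) (wedge x y) =
      inner ℂ a x * inner ℂ b y - inner ℂ a y * inner ℂ b x := by
  have h : (((1 / Real.sqrt 2 : ℝ) : ℂ)) * ((1 / Real.sqrt 2 : ℝ) : ℂ) = 1 / 2 := by
    rw [← Complex.ofReal_mul]
    have : (1 / Real.sqrt 2) * (1 / Real.sqrt 2) = (1 / 2 : ℝ) := by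
      rw [div_mul_div_comm, Real.mul_self_sqrt (by norm_num)]; norm_num
    rw [this]; norm_num
  have hs : ∀ (c : ℂ) (s t : H ⊗[ℂ] H),
      inner ℂ (c • s) (c • t) = (starRingEnd ℂ c * c) * inner ℂ s t := by
    intro c s t
    exact (inner_smul_left s (c • t) c).trans
      ((congrArg _ (inner_smul_right s t c)).trans (mul_assoc _ _ _).symm)
  have hd : inner ℂ (a ⊗ₜ[ℂ] b - b ⊗ₜ[ℂ] a) (x ⊗ₜ[ℂ] y - y ⊗ₜ[ℂ] x) =
      2 * (inner ℂ a x * inner ℂ b y - inner ℂ a y * inner ℂ b x) := by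
    have h1 := inner_sub_left (𝕜 := ℂ) (a ⊗ₜ[ℂ] b) (b ⊗ₜ[ℂ] a) (x ⊗ₜ[ℂ] y - y ⊗ₜ[ℂ] x)
    have h2 := fun s : H ⊗[ℂ] H => inner_sub_right (𝕜 := ℂ) s (x ⊗ₜ[ℂ] y) (y ⊗ₜ[ℂ] x)
    refine h1.trans ?_
    refine (congrArg₂ (· - ·) (h2 _) (h2 _)).trans ?_
    simp only [TensorProduct.inner_tmul]
    ring
  rw [ExtSq.inner_eq, toTensor_wedge, toTensor_wedge, hs, hd, Complex.conj_ofReal, h]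
  ring

theorem wedge_add_left (x x' y : H) : wedge (x + x') y = wedge x y + wedge x' y := by
  apply ExtSq.ext
  simp only [ExtSq.toTensor_add, toTensor_wedge, TensorProduct.add_tmul, TensorProduct.tmul_add,
    ← smul_add]
  congr 1; abel

theorem wedge_smul_left (c : ℂ) (x y : H) : wedge (c • x) y = c • wedge x y := by
  apply ExtSq.ext
  rw [ExtSq.toTensor_smul, toTensor_wedge, toTensor_wedge, TensorProduct.tmul_smul,
    ← TensorProduct.smul_tmul', ← smul_sub, smul_comm]

theorem wedge_swap (x y : H) : wedge y x = -wedge x y := by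
  apply ExtSq.ext
  rw [ExtSq.toTensor_neg, toTensor_wedge, toTensor_wedge, ← smul_neg, neg_sub]

theorem wedge_self (x : H) : wedge x x = 0 := by
  apply ExtSq.ext
  rw [toTensor_wedge, sub_self, smul_zero, ExtSq.toTensor_zero]

theorem wedge_add_right (x y y' : H) : wedge x (y + y') = wedge x y + wedge x y' := by
  rw [wedge_swap, wedge_add_left, neg_add, ← wedge_swap, ← wedge_swap]

theorem wedge_smul_right (c : ℂ) (x y : H) : wedge x (c • y) = c • wedge x y := by
  rw [wedge_swap, wedge_smul_left, wedge_swap x y, smul_neg, neg_neg]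

/-- For a subspace `W ⊆ H`, the subspace `Λ²(W) ⊆ Λ²(H)` spanned by all `x ∧ y`, `x, y ∈ W`. -/
def extSqOf (W : Submodule ℂ H) : Submodule ℂ (ExtSq H) :=
  Submodule.span ℂ {t | ∃ x ∈ W, ∃ y ∈ W, t = wedge x y}

theorem finrank_extSqOf {W : Submodule ℂ H} (hW : Module.finrank ℂ W = 3) :
    Module.finrank ℂ (extSqOf W) = 3 := by
  have : FiniteDimensional ℂ W := Module.finite_of_finrank_eq_succ hW
  let b : OrthonormalBasis (Fin 3) ℂ W := (stdOrthonormalBasis ℂ W).reindex (finCongr hW)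
  let v : Fin 3 → H := fun i => (b i : H)
  have hv : ∀ i j, inner ℂ (v i) (v j) = if i = j then (1 : ℂ) else 0 := by
    intro i j
    exact (orthonormal_iff_ite.mp b.orthonormal) i j
  have hvW : ∀ i, v i ∈ W := fun i => (b i).2
  let w : Fin 3 → ExtSq H := ![wedge (v 0) (v 1), wedge (v 0) (v 2), wedge (v 1) (v 2)]
  have hw : Orthonormal ℂ w := by
    rw [orthonormal_iff_ite]
    intro i j
    fin_cases i <;> fin_cases j <;> simp [w, inner_wedge, hv, -inner_self_eq_norm_sq_to_K]
  have hspan : extSqOf W = Submodule.span ℂ (Set.range w) := by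
    apply le_antisymm
    · apply Submodule.span_le.mpr
      rintro _ ⟨x, hx, y, hy, rfl⟩
      have hex : ∀ u ∈ W, ∃ c : Fin 3 → ℂ, u = c 0 • v 0 + c 1 • v 1 + c 2 • v 2 := by
        intro u hu
        refine ⟨fun i => b.repr ⟨u, hu⟩ i, ?_⟩
        have h := congrArg (fun t : W => (t : H)) (b.sum_repr ⟨u, hu⟩)
        simp only [Fin.sum_univ_three, Submodule.coe_add, Submodule.coe_smul] at h
        exact h.symm
      obtain ⟨c, rfl⟩ := hex x hx
      obtain ⟨d, rfl⟩ := hex y hy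
      have h0 : wedge (v 0) (v 1) ∈ Submodule.span ℂ (Set.range w) :=
        Submodule.subset_span ⟨0, rfl⟩
      have h1 : wedge (v 0) (v 2) ∈ Submodule.span ℂ (Set.range w) :=
        Submodule.subset_span ⟨1, rfl⟩
      have h2 : wedge (v 1) (v 2) ∈ Submodule.span ℂ (Set.range w) :=
        Submodule.subset_span ⟨2, rfl⟩
      have key : wedge (c 0 • v 0 + c 1 • v 1 + c 2 • v 2) (d 0 • v 0 + d 1 • v 1 + d 2 • v 2) =
          (c 0 * d 1 - c 1 * d 0) • wedge (v 0) (v 1) +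
          (c 0 * d 2 - c 2 * d 0) • wedge (v 0) (v 2) +
          (c 1 * d 2 - c 2 * d 1) • wedge (v 1) (v 2) := by
        simp only [wedge_add_left, wedge_add_right, wedge_smul_left, wedge_smul_right, wedge_self,
          wedge_swap (v 0) (v 1), wedge_swap (v 0) (v 2), wedge_swap (v 1) (v 2)]
        module
      rw [key]
      exact add_mem (add_mem (Submodule.smul_mem _ _ h0) (Submodule.smul_mem _ _ h1))
        (Submodule.smul_mem _ _ h2)
    · apply Submodule.span_le.mpr
      rintro _ ⟨i, rfl⟩
      fin_cases i
      · exact Submodule.subset_span ⟨v 0, hvW 0, v 1, hvW 1, rfl⟩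
      · exact Submodule.subset_span ⟨v 0, hvW 0, v 2, hvW 2, rfl⟩
      · exact Submodule.subset_span ⟨v 1, hvW 1, v 2, hvW 2, rfl⟩
  rw [hspan, finrank_span_eq_card hw.linearIndependent, Fintype.card_fin]

end Exterior

section Dist

variable {H : Type*} [NormedAddCommGroup H] [InnerProductSpace ℂ H]

/-- A unit vector representing the point `p` of the projective space `ℙ(H)`. -/
def unitRep (p : ℙ ℂ H) : H := ((‖p.rep‖⁻¹ : ℝ) : ℂ) • p.rep

/-- The function `d_E(p, q) = ‖E (x ∧ y)‖` on `ℙ(H)`, where `x`, `y` are unit vectors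
representing `p`, `q`; see `projDist_mk` for the independence of the representatives. -/
def projDist (E : Module.End ℂ (ExtSq H)) (p q : ℙ ℂ H) : ℝ :=
  ‖E (wedge (unitRep p) (unitRep q))‖

theorem projDist_mk (E : Module.End ℂ (ExtSq H)) (x y : H) (hx : x ≠ 0) (hy : y ≠ 0)
    (hx1 : ‖x‖ = 1) (hy1 : ‖y‖ = 1) :
    projDist E (Projectivization.mk ℂ x hx) (Projectivization.mk ℂ y hy) = ‖E (wedge x y)‖ := by
  have key : ∀ (u : H) (hu : u ≠ 0), ‖u‖ = 1 →
      ∃ c : ℂ, ‖c‖ = 1 ∧ unitRep (Projectivization.mk ℂ u hu) = c • u := by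
    intro u hu hu1
    obtain ⟨a, ha⟩ := Projectivization.exists_smul_eq_mk_rep ℂ u hu
    have ha' : (a : ℂ) • u = (Projectivization.mk ℂ u hu).rep := ha
    have hn : ‖(a : ℂ)‖ ≠ 0 := norm_ne_zero_iff.mpr a.ne_zero
    refine ⟨((‖(a : ℂ)‖⁻¹ : ℝ) : ℂ) * (a : ℂ), ?_, ?_⟩
    · rw [norm_mul, Complex.norm_real, norm_inv, norm_norm, inv_mul_cancel₀ hn]
    · rw [unitRep, ← ha', norm_smul, hu1, mul_one, smul_smul]
  obtain ⟨c, hc, hcx⟩ := key x hx hx1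
  obtain ⟨d, hd, hdy⟩ := key y hy hy1
  rw [projDist, hcx, hdy, wedge_smul_left, wedge_smul_right, map_smul, map_smul, norm_smul,
    norm_smul, hc, hd, one_mul, one_mul]

end Dist

section Compression

variable {V : Type*} [NormedAddCommGroup V] [InnerProductSpace ℂ V] [FiniteDimensional ℂ V]

/-- The restriction of a self-adjoint operator `A` to a subspace `S` (its compression): the
operator `B` on `S` with `⟪B X, Y⟫ = ⟪A X, Y⟫` for all `X, Y ∈ S`. -/
def restriction (A : Module.End ℂ V) (S : Submodule ℂ V) : Module.End ℂ S :=
  S.orthogonalProjectionOnto.toLinearMap ∘ₗ A ∘ₗ S.subtype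

theorem inner_restriction (A : Module.End ℂ V) (S : Submodule ℂ V) (X Y : S) :
    inner ℂ (restriction A S X) Y = inner ℂ (A X) (Y : V) := by
  simp [restriction]

theorem restriction_isSymmetric {A : Module.End ℂ V} (hA : A.IsSymmetric) (S : Submodule ℂ V) :
    (restriction A S).IsSymmetric := by
  intro X Y
  rw [inner_restriction, hA, ← inner_conj_symm X, inner_restriction, inner_conj_symm]

end Compression

section Eigenvalues

variable {H : Type*} [NormedAddCommGroup H] [InnerProductSpace ℂ H] [FiniteDimensional ℂ H]

/-- The restriction `F(W)` of `E²` to `Λ²(W)`. -/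
def restrSq (E : Module.End ℂ (ExtSq H)) (W : Submodule ℂ H) : Module.End ℂ (extSqOf W) :=
  restriction (E ^ 2) (extSqOf W)

theorem restrSq_isSymmetric {E : Module.End ℂ (ExtSq H)} (hE : E.IsSymmetric)
    (W : Submodule ℂ H) : (restrSq E W).IsSymmetric :=
  restriction_isSymmetric (hE.pow 2) (extSqOf W)

/-- For `dim W = 3`: the three eigenvalues, counted with multiplicity and in decreasing order, of
`F(W)` on the three-dimensional space `Λ²(W)`. -/
def eigF {E : Module.End ℂ (ExtSq H)} (hE : E.IsSymmetric) {W : Submodule ℂ H}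
    (hW : Module.finrank ℂ W = 3) : Fin 3 → ℝ :=
  (restrSq_isSymmetric hE W).eigenvalues (finrank_extSqOf hW)

end Eigenvalues

end QuantumDist

end

/-!
Any three points of `ℙ(H)` lie in a three-dimensional `W`, and `Λ²(W)` consists of decomposable tensors: an orthonormal
eigenbasis of `F(W)` is, up to phases, of the form `e₁ ∧ e₂`, `e₂ ∧ e₀`, `e₀ ∧ e₁` for an
orthonormal basis `e` of `W` (`exists_wedgeFrame_eq_smul`). In the coordinates of `e`, with
`s k = √λ k`, the distance becomes (`norm_map_wedge_sq`)

  `d(x, y)² = ∑ k, (s k)² |x (k+1) * y (k+2) - x (k+2) * y (k+1)|²`.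

If `d` satisfies the triangle inequality, applying it to the points of `e₁`, `e₂`, `e₀`, whose
mutual distances are the `s k`, gives `s 0 ≤ s 1 + s 2`.

Conversely, `d(x, y)²` is a quadratic form in the difference `M = x x* - y y*`, which is Hermitian
of trace zero: it equals `∑ k, (s k)² (|M (k+1) (k+2)|² - m (k+1) * m (k+2))`, where `m` is the
diagonal of `M`. On triples with sum zero, the form `-∑ k, (s k)² m (k+1) * m (k+2)` is positive
semidefinite exactly when `s 0`, `s 1`, `s 2` are the side lengths of a triangle; it is then
`|m 0 * p + m 1 * q|²` for two side vectors `p`, `q` of this triangle. Hence `d` is the distance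
between the images of `x` and `y` under an explicit map into a Euclidean space, `chordalMap`
(`norm_chordalMap_sub_sq`), and the triangle inequality for `d` is the one of that space.
-/

noncomputable section

namespace QuantumDist

/-! ### The Euclidean model in three coordinates -/

/-- A triangle with side lengths `a`, `b`, `c` exists: one side is the vector `(b, 0)`, another is
`(u, v)` of length `a`, and the second equation is the law of cosines for the third. Degenerate
triangles, including `b = 0`, are allowed. -/
theorem exists_triangle {a b c : ℝ} (ha : 0 ≤ a) (hb : 0 ≤ b) (hc : 0 ≤ c) (habc : a ≤ b + c)
    (hbac : b ≤ a + c) (hcab : c ≤ a + b) :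
    ∃ u v : ℝ, u ^ 2 + v ^ 2 = a ^ 2 ∧ 2 * b * u = a ^ 2 + b ^ 2 - c ^ 2 := by
  rcases hb.eq_or_lt with rfl | hb
  · obtain rfl : a = c := by linarith
    exact ⟨a, 0, by ring, by ring⟩
  · have hu : |(a ^ 2 + b ^ 2 - c ^ 2) / (2 * b)| ≤ a := by
      rw [abs_le, le_div_iff₀ (by positivity), div_le_iff₀ (by positivity)]
      constructor <;> nlinarith
    have hu2 := sq_le_sq' (abs_le.mp hu).1 (abs_le.mp hu).2
    refine ⟨(a ^ 2 + b ^ 2 - c ^ 2) / (2 * b),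
      Real.sqrt (a ^ 2 - ((a ^ 2 + b ^ 2 - c ^ 2) / (2 * b)) ^ 2), ?_, by field_simp⟩
    rw [Real.sq_sqrt (by linarith)]
    ring

/-- The squared `2 × 2` minor of two vectors `(a, b)`, `(c, d)`, as minus the determinant of the
difference of the rank-one matrices that they define. -/
theorem norm_minor_sq (a b c d : ℂ) :
    ‖a * d - b * c‖ ^ 2 = ‖a * star b - c * star d‖ ^ 2 -
      (‖a‖ ^ 2 - ‖c‖ ^ 2) * (‖b‖ ^ 2 - ‖d‖ ^ 2) := by
  simp only [← Complex.normSq_eq_norm_sq, Complex.normSq_apply, Complex.sub_re, Complex.sub_im,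
    Complex.mul_re, Complex.mul_im, Complex.star_def, Complex.conj_re, Complex.conj_im]
  ring

/-- The map sending a unit vector `x` of `ℂ³` to the off-diagonal entries of `x x*`, weighted by
`s`, together with the combination `|x 0|² * s 1 + |x 1|² * q` of its diagonal entries. Here `s 1`
(as a real number) and `q` are meant to be two sides, seen as vectors in the plane `ℂ`, of a
triangle with side lengths `s 0`, `s 1`, `s 2`. -/
def chordalMap (s : Fin 3 → ℝ) (q : ℂ) (x : Fin 3 → ℂ) : EuclideanSpace ℂ (Fin 4) :=
  !₂[s 0 * (x 1 * star (x 2)), s 1 * (x 2 * star (x 0)), s 2 * (x 0 * star (x 1)),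
    ((‖x 0‖ ^ 2 * s 1 : ℝ) : ℂ) + ((‖x 1‖ ^ 2 : ℝ) : ℂ) * q]

/-- The distance of the images under `chordalMap` is the diagonal model of `d_E`. -/
theorem norm_chordalMap_sub_sq {s : Fin 3 → ℝ} {q : ℂ} (hq : ‖q‖ ^ 2 = s 0 ^ 2)
    (hq' : 2 * s 1 * q.re = s 0 ^ 2 + s 1 ^ 2 - s 2 ^ 2) {x y : Fin 3 → ℂ}
    (hx : ∑ i, ‖x i‖ ^ 2 = 1) (hy : ∑ i, ‖y i‖ ^ 2 = 1) :
    ‖chordalMap s q x - chordalMap s q y‖ ^ 2 =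
      ∑ k, s k ^ 2 * ‖x (k + 1) * y (k + 2) - x (k + 2) * y (k + 1)‖ ^ 2 := by
  have hlast : ‖((‖x 0‖ ^ 2 * s 1 : ℝ) : ℂ) + ((‖x 1‖ ^ 2 : ℝ) : ℂ) * q -
      (((‖y 0‖ ^ 2 * s 1 : ℝ) : ℂ) + ((‖y 1‖ ^ 2 : ℝ) : ℂ) * q)‖ ^ 2 =
      s 1 ^ 2 * (‖x 0‖ ^ 2 - ‖y 0‖ ^ 2) ^ 2 +
      2 * s 1 * q.re * (‖x 0‖ ^ 2 - ‖y 0‖ ^ 2) * (‖x 1‖ ^ 2 - ‖y 1‖ ^ 2) +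
      ‖q‖ ^ 2 * (‖x 1‖ ^ 2 - ‖y 1‖ ^ 2) ^ 2 := by
    rw [← Complex.normSq_eq_norm_sq, ← Complex.normSq_eq_norm_sq q, Complex.normSq_apply,
      Complex.normSq_apply]
    simp only [Complex.sub_re, Complex.sub_im, Complex.add_re, Complex.add_im, Complex.re_ofReal_mul,
      Complex.im_ofReal_mul, Complex.ofReal_re, Complex.ofReal_im]
    ring
  have hoff : ∀ (r : ℝ) (a b : ℂ), ‖(r : ℂ) * a - r * b‖ ^ 2 = r ^ 2 * ‖a - b‖ ^ 2 := by
    intro r a b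
    rw [← mul_sub, norm_mul, mul_pow, Complex.norm_real, Real.norm_eq_abs, sq_abs]
  rw [EuclideanSpace.norm_sq_eq, Fin.sum_univ_four, Fin.sum_univ_three]
  have e1 : (1 + 1 : Fin 3) = 2 := rfl
  have e2 : (1 + 2 : Fin 3) = 0 := rfl
  have e3 : (2 + 1 : Fin 3) = 0 := rfl
  have e4 : (2 + 2 : Fin 3) = 1 := rfl
  rw [Fin.sum_univ_three] at hx hy
  simp only [e1, e2, e3, e4, zero_add, chordalMap, PiLp.sub_apply,
    Matrix.cons_val, hoff, hlast, hq, hq']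
  rw [norm_minor_sq (x 1) (x 2) (y 1) (y 2), norm_minor_sq (x 2) (x 0) (y 2) (y 0),
    norm_minor_sq (x 0) (x 1) (y 0) (y 1)]
  have hx2 : ‖x 2‖ ^ 2 = 1 - ‖x 0‖ ^ 2 - ‖x 1‖ ^ 2 := by linarith
  have hy2 : ‖y 2‖ ^ 2 = 1 - ‖y 0‖ ^ 2 - ‖y 1‖ ^ 2 := by linarith
  -- The diagonal entries sum to one, so that the last one can be eliminated.
  rw [hx2, hy2]
  ring

/-! ### Orthonormal frames of the exterior square -/

section Frame

variable {H : Type*} [NormedAddCommGroup H] [InnerProductSpace ℂ H]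

/-- The frame `e₁ ∧ e₂`, `e₂ ∧ e₀`, `e₀ ∧ e₁` defined by three vectors; the indices are taken
modulo three, so that the coefficients of a wedge product in it are those of a cross product. -/
def wedgeFrame (e : Fin 3 → H) (k : Fin 3) : ExtSq H := wedge (e (k + 1)) (e (k + 2))

theorem orthonormal_wedgeFrame {e : Fin 3 → H} (he : Orthonormal ℂ e) :
    Orthonormal ℂ (wedgeFrame e) := by
  rw [orthonormal_iff_ite] at he ⊢
  intro i j
  simp only [wedgeFrame, inner_wedge, he]
  fin_cases i <;> fin_cases j <;> simp

theorem wedge_sum_smul (e : Fin 3 → H) (x y : Fin 3 → ℂ) :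
    wedge (∑ i, x i • e i) (∑ i, y i • e i) =
      ∑ k, (x (k + 1) * y (k + 2) - x (k + 2) * y (k + 1)) • wedgeFrame e k := by
  have e1 : (1 + 1 : Fin 3) = 2 := rfl
  have e2 : (1 + 2 : Fin 3) = 0 := rfl
  have e3 : (2 + 1 : Fin 3) = 0 := rfl
  have e4 : (2 + 2 : Fin 3) = 1 := rfl
  simp only [Fin.sum_univ_three, wedgeFrame, wedge_add_left, wedge_add_right, wedge_smul_left,
    wedge_smul_right, wedge_self, e1, e2, e3, e4, zero_add,
    wedge_swap (e 0) (e 1), wedge_swap (e 2) (e 0), wedge_swap (e 1) (e 2)]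
  module

theorem wedge_mem_extSqOf {W : Submodule ℂ H} {x y : H} (hx : x ∈ W) (hy : y ∈ W) :
    wedge x y ∈ extSqOf W :=
  Submodule.subset_span ⟨x, hx, y, hy, rfl⟩

theorem exists_orthonormalBasis_wedgeFrame {W : Submodule ℂ H} (hW : Module.finrank ℂ W = 3)
    (e : OrthonormalBasis (Fin 3) ℂ W) :
    ∃ w : OrthonormalBasis (Fin 3) ℂ (extSqOf W),
      ∀ k, (w k : ExtSq H) = wedgeFrame (fun i => (e i : H)) k := by
  have ho : Orthonormal ℂ fun k => (⟨wedgeFrame (fun i => (e i : H)) k,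
      wedge_mem_extSqOf (e _).2 (e _).2⟩ : extSqOf W) :=
    (orthonormal_wedgeFrame (e.orthonormal.comp_linearIsometry W.subtypeₗᵢ)).codRestrict _ _
  have hc : Fintype.card (Fin 3) = Module.finrank ℂ (extSqOf W) := by
    rw [finrank_extSqOf hW, Fintype.card_fin]
  refine ⟨(basisOfOrthonormalOfCardEqFinrank ho hc).toOrthonormalBasis (by simpa using ho), ?_⟩
  intro k
  simp

/-- Every orthonormal basis of `Λ²(W)`, for `dim W = 3`, is up to phases the frame of an orthonormal
basis of `W`. The latter consists of the Hodge duals of the given basis vectors. -/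
theorem exists_wedgeFrame_eq_smul {W : Submodule ℂ H} (hW : Module.finrank ℂ W = 3)
    (v : OrthonormalBasis (Fin 3) ℂ (extSqOf W)) :
    ∃ e : OrthonormalBasis (Fin 3) ℂ W, ∀ k, ∃ c : ℂ, ‖c‖ = 1 ∧
      wedgeFrame (fun i => (e i : H)) k = c • (v k : ExtSq H) := by
  have : FiniteDimensional ℂ W := Module.finite_of_finrank_eq_succ hW
  let b : OrthonormalBasis (Fin 3) ℂ W := (stdOrthonormalBasis ℂ W).reindex (finCongr hW)
  obtain ⟨w, hw⟩ := exists_orthonormalBasis_wedgeFrame hW b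
  -- The Hodge dual of `v k`: a conjugate-linear isometric image of `v k` in `W`.
  let f : Fin 3 → W := fun k => ∑ i, inner ℂ (v k) (w i) • b i
  have hf : Orthonormal ℂ f := by
    rw [orthonormal_iff_ite]
    intro j k
    rw [b.orthonormal.inner_sum]
    simp only [inner_conj_symm]
    have := w.sum_inner_mul_inner (v k) (v j)
    simp only [mul_comm] at this ⊢
    rw [this, orthonormal_iff_ite.mp v.orthonormal]
    simp [eq_comm]
  have hc : Fintype.card (Fin 3) = Module.finrank ℂ W := by rw [hW, Fintype.card_fin]
  let e : OrthonormalBasis (Fin 3) ℂ W :=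
    (basisOfOrthonormalOfCardEqFinrank hf hc).toOrthonormalBasis (by simpa using hf)
  have he : ∀ k, e k = f k := fun k => by simp [e]
  have hcoe : ∀ k, (f k : H) = ∑ i, inner ℂ (v k) (w i) • (b i : H) := by
    intro k; simp [f]
  -- The pairing of `v` with a wedge product is a determinant, here with two equal rows.
  have hpair : ∀ j k, inner ℂ (v j : ExtSq H) (wedge (f j : H) (f k)) = 0 := by
    intro j k
    rw [hcoe, hcoe, wedge_sum_smul, inner_sum]
    simp only [inner_smul_right, ← hw, ← Submodule.coe_inner, Fin.sum_univ_three]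
    have e1 : (1 + 1 : Fin 3) = 2 := rfl
    have e2 : (1 + 2 : Fin 3) = 0 := rfl
    have e3 : (2 + 1 : Fin 3) = 0 := rfl
    have e4 : (2 + 2 : Fin 3) = 1 := rfl
    simp only [e1, e2, e3, e4, zero_add]
    ring
  have hpair' : ∀ j k, inner ℂ (v k : ExtSq H) (wedge (f j : H) (f k)) = 0 := by
    intro j k
    rw [wedge_swap, inner_neg_right, hpair, neg_zero]
  obtain ⟨w', hw'⟩ := exists_orthonormalBasis_wedgeFrame hW e
  refine ⟨e, fun k => ⟨inner ℂ (v k) (w' k), ?_⟩⟩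
  have horth : ∀ l, l ≠ k → inner ℂ (v l) (w' k) = 0 := by
    intro l hl
    rw [Submodule.coe_inner, hw', wedgeFrame, he, he]
    have : l = k + 1 ∨ l = k + 2 := by
      revert l k; decide
    rcases this with rfl | rfl
    · exact hpair _ _
    · exact hpair' _ _
  have hkey : w' k = inner ℂ (v k) (w' k) • v k := by
    conv_lhs => rw [← v.sum_repr' (w' k)]
    refine Finset.sum_eq_single k (fun l _ hl => ?_) (by simp)
    rw [horth l hl, zero_smul]
  constructor
  · have := congrArg norm hkey
    rwa [norm_smul, w'.norm_eq_one, v.norm_eq_one, mul_one, eq_comm] at this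
  · rw [← hw']
    exact congrArg Subtype.val hkey

theorem norm_sum_smul_sq {V : Type*} [NormedAddCommGroup V] [InnerProductSpace ℂ V]
    {ι : Type*} [Fintype ι] [DecidableEq ι] {u : ι → V} {l : ι → ℝ}
    (hl : ∀ j k, inner ℂ (u j) (u k) = if j = k then (l k : ℂ) else 0) (c : ι → ℂ) :
    ‖∑ k, c k • u k‖ ^ 2 = ∑ k, l k * ‖c k‖ ^ 2 := by
  apply Complex.ofReal_injective
  rw [Complex.ofReal_pow]
  refine (inner_self_eq_norm_sq_to_K (𝕜 := ℂ) (∑ k, c k • u k)).symm.trans ?_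
  simp only [sum_inner, inner_sum, inner_smul_left, inner_smul_right, hl, mul_ite, mul_zero,
    Finset.sum_ite_eq', Finset.mem_univ, if_true, Complex.ofReal_sum,
    Complex.ofReal_mul, Complex.ofReal_pow, ← Complex.conj_mul']
  exact Finset.sum_congr rfl fun k _ => by ring

theorem norm_map_wedge_sq {E : Module.End ℂ (ExtSq H)} {e : Fin 3 → H} {l : Fin 3 → ℝ}
    (hl : ∀ j k, inner ℂ (E (wedgeFrame e j)) (E (wedgeFrame e k)) =
      if j = k then (l k : ℂ) else 0) (x y : Fin 3 → ℂ) :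
    ‖E (wedge (∑ i, x i • e i) (∑ i, y i • e i))‖ ^ 2 =
      ∑ k, l k * ‖x (k + 1) * y (k + 2) - x (k + 2) * y (k + 1)‖ ^ 2 := by
  simp only [wedge_sum_smul, map_sum, map_smul, norm_sum_smul_sq hl]

theorem norm_unitRep (p : ℙ ℂ H) : ‖unitRep p‖ = 1 := by
  rw [unitRep, norm_smul, Complex.norm_real, norm_inv, norm_norm,
    inv_mul_cancel₀ (norm_ne_zero_iff.mpr p.rep_nonzero)]

end Frame

/-! ### The eigenbasis of `F(W)` and the triangle inequality -/

section Compression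

variable {H : Type*} [NormedAddCommGroup H] [InnerProductSpace ℂ H] [FiniteDimensional ℂ H]

theorem exists_le_finrank_eq (S : Submodule ℂ H) {n : ℕ} (h1 : Module.finrank ℂ S ≤ n)
    (h2 : n ≤ Module.finrank ℂ H) :
    ∃ W : Submodule ℂ H, S ≤ W ∧ Module.finrank ℂ W = n := by
  induction n, h1 using Nat.le_induction with
  | base => exact ⟨S, le_rfl, rfl⟩
  | succ n _ ih =>
    obtain ⟨W, hSW, hW⟩ := ih (by omega)
    have hlt : W < ⊤ := lt_top_iff_ne_top.mpr fun h => by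
      rw [h, finrank_top] at hW
      omega
    obtain ⟨v, -, hv⟩ := SetLike.exists_of_lt hlt
    exact ⟨W ⊔ ℂ ∙ v, hSW.trans le_sup_left, by rw [Submodule.finrank_sup_span_singleton hv, hW]⟩

theorem inner_map_map_coe {E : Module.End ℂ (ExtSq H)} (hE : E.IsSymmetric) (W : Submodule ℂ H)
    (X Y : extSqOf W) : inner ℂ (E X) (E Y) = inner ℂ (restrSq E W X) Y := by
  rw [restrSq, inner_restriction, pow_two, Module.End.mul_apply, ← hE]

theorem eigF_nonneg {E : Module.End ℂ (ExtSq H)} (hE : E.IsSymmetric) {W : Submodule ℂ H}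
    (hW : Module.finrank ℂ W = 3) (k : Fin 3) : 0 ≤ eigF hE hW k := by
  refine LinearMap.IsPositive.nonneg_eigenvalues ⟨restrSq_isSymmetric hE W, fun X => ?_⟩ _ k
  rw [← inner_map_map_coe hE]
  exact inner_self_nonneg

/-- An orthonormal basis of `W` whose frame diagonalizes `F(W)`. -/
theorem exists_adapted_basis {E : Module.End ℂ (ExtSq H)} (hE : E.IsSymmetric) {W : Submodule ℂ H}
    (hW : Module.finrank ℂ W = 3) :
    ∃ e : OrthonormalBasis (Fin 3) ℂ W, ∀ j k,
      inner ℂ (E (wedgeFrame (fun i => (e i : H)) j)) (E (wedgeFrame (fun i => (e i : H)) k)) =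
        if j = k then (eigF hE hW k : ℂ) else 0 := by
  let v := (restrSq_isSymmetric hE W).eigenvectorBasis (finrank_extSqOf hW)
  obtain ⟨e, he⟩ := exists_wedgeFrame_eq_smul hW v
  refine ⟨e, fun j k => ?_⟩
  obtain ⟨c, hc, hcj⟩ := he j
  obtain ⟨d, hd, hdk⟩ := he k
  have hv : inner ℂ (E (v j)) (E (v k)) = if j = k then (eigF hE hW k : ℂ) else 0 := by
    rw [inner_map_map_coe hE, LinearMap.IsSymmetric.apply_eigenvectorBasis, inner_smul_left,
      orthonormal_iff_ite.mp v.orthonormal]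
    split_ifs with h
    · subst h; simp [eigF]
    · simp
  rw [hcj, hdk, map_smul, map_smul, inner_smul_left, inner_smul_right, hv]
  split_ifs with h
  · subst h
    have hcd : c = d := smul_left_injective ℂ
      (show (v j : ExtSq H) ≠ 0 by simpa using v.orthonormal.ne_zero j) (hcj.symm.trans hdk)
    subst hcd
    rw [← mul_assoc, Complex.conj_mul', hc]
    simp
  · simp

theorem norm_map_wedge_triangle {E : Module.End ℂ (ExtSq H)} (hE : E.IsSymmetric)
    {W : Submodule ℂ H} (hW : Module.finrank ℂ W = 3)
    (h : Real.sqrt (eigF hE hW 0) ≤ Real.sqrt (eigF hE hW 1) + Real.sqrt (eigF hE hW 2))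
    {x y z : H} (hx : x ∈ W) (hy : y ∈ W) (hz : z ∈ W) (hx1 : ‖x‖ = 1) (hy1 : ‖y‖ = 1)
    (hz1 : ‖z‖ = 1) : ‖E (wedge x y)‖ ≤ ‖E (wedge x z)‖ + ‖E (wedge z y)‖ := by
  obtain ⟨e, he⟩ := exists_adapted_basis hE hW
  set s : Fin 3 → ℝ := fun k => Real.sqrt (eigF hE hW k) with hs
  have hanti : ∀ {i j : Fin 3}, i ≤ j → s j ≤ s i := fun hij =>
    Real.sqrt_le_sqrt ((restrSq_isSymmetric hE W).eigenvalues_antitone (finrank_extSqOf hW) hij)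
  have hs0 : ∀ k, 0 ≤ s k := fun k => Real.sqrt_nonneg _
  -- The eigenvalues decrease, so that the other two triangle inequalities for `s` are automatic.
  obtain ⟨u, v, huv, hu⟩ := exists_triangle (hs0 0) (hs0 1) (hs0 2) h
    (by linarith [hanti (show (0 : Fin 3) ≤ 1 by decide), hs0 2])
    (by linarith [hanti (show (0 : Fin 3) ≤ 2 by decide), hs0 1])
  have hq : ‖(⟨u, v⟩ : ℂ)‖ ^ 2 = s 0 ^ 2 := by
    rw [← Complex.normSq_eq_norm_sq, Complex.normSq_mk, ← huv]
    ring
  have hdist : ∀ a b : H, a ∈ W → b ∈ W → ‖a‖ = 1 → ‖b‖ = 1 → ‖E (wedge a b)‖ =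
      dist (chordalMap s ⟨u, v⟩ fun i => inner ℂ (e i : H) a)
        (chordalMap s ⟨u, v⟩ fun i => inner ℂ (e i : H) b) := by
    intro a b ha hb ha1 hb1
    have hrep : ∀ t ∈ W, ∑ i, inner ℂ (e i : H) t • (e i : H) = t := by
      intro t ht
      simpa using congrArg Subtype.val (e.sum_repr' ⟨t, ht⟩)
    have hone : ∀ t ∈ W, ‖t‖ = 1 → ∑ i, ‖inner ℂ (e i : H) t‖ ^ 2 = 1 := by
      intro t ht ht1
      have := e.sum_sq_norm_inner_right ⟨t, ht⟩
      simpa [ht1] using this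
    rw [dist_eq_norm, ← sq_eq_sq₀ (norm_nonneg _) (norm_nonneg _),
      norm_chordalMap_sub_sq hq hu (hone a ha ha1) (hone b hb hb1)]
    conv_lhs => rw [← hrep a ha, ← hrep b hb]
    rw [norm_map_wedge_sq he]
    simp only [hs, Real.sq_sqrt (eigF_nonneg hE hW _)]
  rw [hdist x y hx hy hx1 hy1, hdist x z hx hz hx1 hz1, hdist z y hz hy hz1 hy1]
  exact dist_triangle _ _ _

end Compression
end QuantumDist

end

open QuantumDist in
theorem theorem4p1 {H : Type*} [NormedAddCommGroup H] [InnerProductSpace ℂ H]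
    [FiniteDimensional ℂ H] (hH : 3 ≤ Module.finrank ℂ H)
    (E : Module.End ℂ (QuantumDist.ExtSq H)) (hE : E.IsPositive) :
    (∀ x y z : ℙ ℂ H,
        QuantumDist.projDist E x y ≤ QuantumDist.projDist E x z + QuantumDist.projDist E z y) ↔
      ∀ (W : Submodule ℂ H) (hW : Module.finrank ℂ W = 3),
        Real.sqrt (QuantumDist.eigF hE.isSymmetric hW 0) ≤
          Real.sqrt (QuantumDist.eigF hE.isSymmetric hW 1) +
            Real.sqrt (QuantumDist.eigF hE.isSymmetric hW 2) := by
  constructor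
  · -- The points of an adapted basis have the square roots of the eigenvalues as distances.
    intro h W hW
    obtain ⟨e, he⟩ := exists_adapted_basis hE.isSymmetric hW
    have he1 : ∀ i, ‖(e i : H)‖ = 1 := fun i => e.norm_eq_one i
    have he0 : ∀ i, (e i : H) ≠ 0 := fun i => norm_ne_zero_iff.mp (by simp [he1])
    have hsqrt : ∀ k, ‖E (wedge (e (k + 1) : H) (e (k + 2)))‖ =
        Real.sqrt (eigF hE.isSymmetric hW k) := by
      intro k
      have := he k k
      rw [if_pos rfl] at this
      rw [@norm_eq_sqrt_re_inner ℂ, show wedge (e (k + 1) : H) (e (k + 2)) =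
        wedgeFrame (fun i => (e i : H)) k from rfl, this]
      simp
    have htri := h (.mk ℂ (e 1 : H) (he0 1)) (.mk ℂ (e 2 : H) (he0 2)) (.mk ℂ (e 0 : H) (he0 0))
    rw [projDist_mk _ _ _ _ _ (he1 _) (he1 _), projDist_mk _ _ _ _ _ (he1 _) (he1 _),
      projDist_mk _ _ _ _ _ (he1 _) (he1 _)] at htri
    have h0 := hsqrt 0
    have h1 := hsqrt 1
    have h2 := hsqrt 2
    rw [wedge_swap (e 0 : H) (e 1 : H), map_neg, norm_neg] at htri
    rw [wedge_swap (e 2 : H) (e 0 : H), map_neg, norm_neg] at htri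
    rw [← h0, ← h1, ← h2]
    simpa [add_comm] using htri
  · -- Any three points lie in a common three-dimensional subspace.
    intro h x y z
    obtain ⟨W, hSW, hW⟩ := exists_le_finrank_eq
      (Submodule.span ℂ (Set.range ![unitRep x, unitRep y, unitRep z]))
      (finrank_range_le_card _) hH
    have hmem : ∀ i, ![unitRep x, unitRep y, unitRep z] i ∈ W := fun i =>
      hSW (Submodule.subset_span ⟨i, rfl⟩)
    exact norm_map_wedge_triangle hE.isSymmetric hW (h W hW) (hmem 0) (hmem 1) (hmem 2)
      (norm_unitRep x) (norm_unitRep y) (norm_unitRep z)
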